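/- For a prime $p$, call a positive integer $n$ $p$-practical if the polynomial $X^n-1\in\mathbb{F}_p[X]$ has a divisor of degree $m$ for every integer $0\le m\le n$. Call a (unital) ring $R$ almost $n$-torsion clean if every $r\in R$ can be written as $r=u+e$ with $u$ a unit of $R$ satisfying $u^n=1$ and $e\in R$ an idempotent. Write $\mathbb{M}_n(\mathbb{F}_2)$ for the ring of $n\times n$ matrices over $\mathbb{F}_2$. (1) For every integer $n>2$, if $n$ is $2$-practical, then $\mathbb{M}_n(\mathbb{F}_2)$ is almost $n$-torsion clean. (2) The converse of (1) fails: $44$ is not $2$-practical, although $\mathbb{M}_{44}(\mathbb{F}_2)$ is almost $44$-torsion clean. -/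

import Mathlib

/-- `n` is `p`-practical (`p` prime): over the field with `p` elements, `X ^ n - 1` has a divisor
of every degree `m ≤ n`. -/
def IsPPractical (p : ℕ) [Fact p.Prime] (n : ℕ) : Prop :=
  ∀ m : ℕ, m ≤ n →
    ∃ d : Polynomial (ZMod p), d ∣ (Polynomial.X ^ n - 1) ∧ d.natDegree = m

/-- A ring is almost `n`-torsion clean if each of its elements is the sum of a unit `u` with
`u ^ n = 1` and an idempotent. -/
def IsAlmostTorsionClean (R : Type*) [Ring R] (n : ℕ) : Prop :=
  ∀ r : R, ∃ (u : Rˣ) (e : R), u ^ n = 1 ∧ IsIdempotentElem e ∧ r = (u : R) + e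

open Polynomial Module

/-! Over `F_2[X]` a finite-dimensional space with an endomorphism is a direct sum of cyclic modules,
and splittings of the blocks add up. So it suffices to split the companion matrix of each monic `c`
of degree `m`, with `m` at most the dimension (`SplitsTorsion.of_forall_mulXMod`).

For (1), the companion matrix `Q` of a degree `m` divisor `q` of `X ^ n - 1` satisfies `Q ^ n = 1`.
The companion matrix of `c` differs from `Q` only in the last column, and the difference is
idempotent when the traces differ. When they agree and `3 ≤ m`, conjugating `Q` by a suitable
involution makes the difference a projection of rank two. Degrees 1 and 2 are done by hand.

For (2), as `4 ∣ 44`, an idempotent plus `N` with `N ^ 4 = 0` is enough, since `(1 + N) ^ 4 = 1` in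
characteristic 2. For `3 ≤ m`, a basis of products of factors `X - d j` gives a Hessenberg matrix
whose diagonal is free up to its trace; ones placed on it cut the shift into short chains. On the
other side, `X ^ 44 - 1` has only irreducible factors of degree 1 (four of them) and 10, so none of
its divisors has degree 5. -/

/-- `A` is the sum of an endomorphism `U` with `U ^ n = 1` and an idempotent one. -/
def SplitsTorsion (n : ℕ) {V : Type*} [AddCommGroup V] [Module (ZMod 2) V]
    (A : End (ZMod 2) V) : Prop :=
  ∃ U E : End (ZMod 2) V, U ^ n = 1 ∧ E * E = E ∧ A = U + E

/-- `A` is the sum of an idempotent endomorphism and one whose fourth power vanishes. -/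
def SplitsNilpotent {V : Type*} [AddCommGroup V] [Module (ZMod 2) V]
    (A : End (ZMod 2) V) : Prop :=
  ∃ N E : End (ZMod 2) V, N ^ 4 = 0 ∧ E * E = E ∧ A = N + E

/-! ### Splittings: elementary cases, conjugation, direct sums -/

section General

variable {n : ℕ} {V W : Type*} [AddCommGroup V] [Module (ZMod 2) V]
  [AddCommGroup W] [Module (ZMod 2) W]

theorem idempotent_one_add {E : End (ZMod 2) V} (h : E * E = E) :
    (1 + E) * (1 + E) = 1 + E := by
  have h2 : E + E = 0 := ZModModule.add_self E
  calc (1 + E) * (1 + E) = 1 + (E + E) + E * E := by noncomm_ring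
    _ = 1 + E := by rw [h2, h, add_zero]

theorem one_add_pow_four {N : End (ZMod 2) V} (h : N ^ 4 = 0) : (1 + N) ^ 4 = 1 := by
  have h2 : ∀ M : End (ZMod 2) V, M + M = 0 := fun M => ZModModule.add_self M
  have hsq : ∀ M : End (ZMod 2) V, (1 + M) ^ 2 = 1 + M ^ 2 := fun M => by
    calc (1 + M) ^ 2 = 1 + (M + M) + M ^ 2 := by noncomm_ring
      _ = 1 + M ^ 2 := by rw [h2, add_zero]
  rw [show 4 = 2 * 2 from rfl, pow_mul, hsq, hsq, ← pow_mul, h, add_zero]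

/-- In characteristic 2, `N + E = (1 + N) + (1 + E)`. -/
theorem SplitsNilpotent.splitsTorsion {A : End (ZMod 2) V} (h : SplitsNilpotent A)
    (hn : 4 ∣ n) : SplitsTorsion n A := by
  obtain ⟨N, E, hN, hE, rfl⟩ := h
  obtain ⟨k, rfl⟩ := hn
  refine ⟨1 + N, 1 + E, ?_, idempotent_one_add hE, ?_⟩
  · rw [pow_mul, one_add_pow_four hN, one_pow]
  · have h2 : (1 : End (ZMod 2) V) + 1 = 0 := ZModModule.add_self _
    calc N + E = (1 + 1) + (N + E) := by rw [h2, zero_add]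
      _ = 1 + N + (1 + E) := by abel

theorem SplitsTorsion.of_idempotent {A : End (ZMod 2) V} (h : A * A = A) :
    SplitsTorsion n A := by
  refine ⟨1, 1 + A, one_pow n, idempotent_one_add h, ?_⟩
  rw [← add_assoc, ZModModule.add_self, zero_add]

theorem SplitsTorsion.of_pow {A : End (ZMod 2) V} (h : A ^ n = 1) : SplitsTorsion n A :=
  ⟨A, 0, h, by simp, by simp⟩

theorem SplitsTorsion.of_add_one_pow {A : End (ZMod 2) V} (h : (A + 1) ^ n = 1) :
    SplitsTorsion n A :=
  ⟨A + 1, 1, h, by simp, by rw [add_assoc, ZModModule.add_self, add_zero]⟩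

theorem SplitsTorsion.conj {A : End (ZMod 2) V} {B : End (ZMod 2) W} (e : V ≃ₗ[ZMod 2] W)
    (h : SplitsTorsion n A) (hB : ∀ x, B (e x) = e (A x)) : SplitsTorsion n B := by
  obtain ⟨U, E, hU, hE, rfl⟩ := h
  refine ⟨e.conjRingEquiv U, e.conjRingEquiv E, ?_, ?_, ?_⟩
  · rw [← map_pow, hU, map_one]
  · rw [← map_mul, hE]
  · rw [← map_add]
    ext x
    have := hB (e.symm x)
    simpa using this

theorem SplitsTorsion.pi {ι : Type*} {M : ι → Type*} [∀ i, AddCommGroup (M i)]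
    [∀ i, Module (ZMod 2) (M i)] {A : ∀ i, End (ZMod 2) (M i)}
    (h : ∀ i, SplitsTorsion n (A i)) :
    SplitsTorsion n (LinearMap.pi fun i => A i ∘ₗ LinearMap.proj i : End (ZMod 2) (∀ i, M i)) := by
  choose U E hU hE hA using h
  refine ⟨LinearMap.pi fun i => U i ∘ₗ LinearMap.proj i,
    LinearMap.pi fun i => E i ∘ₗ LinearMap.proj i, ?_, ?_, ?_⟩
  · have key : ∀ k : ℕ, ∀ x i, ((LinearMap.pi fun i => U i ∘ₗ LinearMap.proj i :
        End (ZMod 2) (∀ i, M i)) ^ k) x i = (U i ^ k) (x i) := by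
      intro k
      induction k with
      | zero => intro x i; simp
      | succ k ih => intro x i; rw [pow_succ, pow_succ, Module.End.mul_apply, ih]; rfl
    refine LinearMap.ext fun x => funext fun i => ?_
    rw [key, hU]; rfl
  · refine LinearMap.ext fun x => funext fun i => ?_
    exact congrArg (fun f => f (x i)) (hE i)
  · refine LinearMap.ext fun x => funext fun i => ?_
    exact congrArg (fun f => f (x i)) (hA i)

end General

/-! ### Companion endomorphisms -/

theorem degree_eq_of_monic {R : Type*} [Semiring R] [Nontrivial R] {m : ℕ} {c : R[X]}
    (hc : c.Monic) (hm : c.natDegree = m) : c.degree = m := by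
  rw [degree_eq_natDegree hc.ne_zero, hm]

/-- Multiplication by `X` modulo a monic polynomial `c` of degree `m`, acting on the polynomials
of degree less than `m`. -/
noncomputable def mulXMod {m : ℕ} {c : (ZMod 2)[X]} (hc : c.Monic) (hm : c.natDegree = m) :
    End (ZMod 2) (degreeLT (ZMod 2) m) :=
  (modByMonicHom c ∘ₗ LinearMap.mulLeft (ZMod 2) X ∘ₗ
    (degreeLT (ZMod 2) m).subtype).codRestrict _ fun p => by
      rw [mem_degreeLT, ← degree_eq_of_monic hc hm]
      exact degree_modByMonic_lt _ hc

section MulXMod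

variable {m : ℕ} {c : (ZMod 2)[X]} (hc : c.Monic) (hm : c.natDegree = m)

theorem coe_modByMonic_self {m : ℕ} {c : (ZMod 2)[X]} (hc : c.Monic) (hm : c.natDegree = m)
    (p : degreeLT (ZMod 2) m) :
    (p : (ZMod 2)[X]) %ₘ c = p := by
  rw [modByMonic_eq_self_iff hc, degree_eq_of_monic hc hm]
  exact mem_degreeLT.1 p.2

theorem coe_mulXMod (p : degreeLT (ZMod 2) m) :
    (mulXMod hc hm p : (ZMod 2)[X]) = (X * (p : (ZMod 2)[X])) %ₘ c := rfl

theorem coe_mulXMod_pow (k : ℕ) (p : degreeLT (ZMod 2) m) :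
    ((mulXMod hc hm ^ k) p : (ZMod 2)[X]) = (X ^ k * (p : (ZMod 2)[X])) %ₘ c := by
  induction k with
  | zero => simp [coe_modByMonic_self hc hm]
  | succ k ih =>
    rw [pow_succ', Module.End.mul_apply, coe_mulXMod, ih]
    refine modByMonic_eq_of_dvd_sub hc ?_
    have := (dvd_modByMonic_sub (X ^ k * (p : (ZMod 2)[X])) c).mul_left X
    convert this using 1
    ring

theorem mulXMod_pow_eq_one {n : ℕ} (h : c ∣ X ^ n - 1) : mulXMod hc hm ^ n = 1 := by
  ext1 p
  refine Subtype.ext ?_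
  rw [coe_mulXMod_pow]
  rw [Module.End.one_apply]
  nth_rewrite 2 [← coe_modByMonic_self hc hm p]
  refine modByMonic_eq_of_dvd_sub hc ?_
  convert h.mul_right (p : (ZMod 2)[X]) using 1
  ring

/-- The division of `X * p` by `c` has a constant quotient. Hence two such maps for the same `m`
differ by a map that sees only the top coefficient of `p`. -/
theorem coe_mulXMod_eq (h1 : 1 ≤ m) (p : degreeLT (ZMod 2) m) :
    (mulXMod hc hm p : (ZMod 2)[X]) = X * (p : (ZMod 2)[X]) - C ((p : (ZMod 2)[X]).coeff (m - 1)) * c := by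
  rw [coe_mulXMod]
  have hp := mem_degreeLT.1 p.2
  refine (div_modByMonic_unique (C ((p : (ZMod 2)[X]).coeff (m - 1))) _ hc ⟨by ring, ?_⟩).2
  rw [degree_eq_of_monic hc hm, degree_lt_iff_coeff_zero]
  intro k hk
  obtain ⟨k, rfl⟩ : ∃ j, k = j + 1 := ⟨k - 1, by omega⟩
  rw [coeff_sub, coeff_X_mul, coeff_C_mul]
  rcases hk.eq_or_lt with h | h
  · have : c.coeff (k + 1) = 1 := by rw [← h, ← hm]; exact hc
    rw [this, show m - 1 = k by omega]; ring
  · rw [(degree_lt_iff_coeff_zero _ _).1 hp k (by omega), coeff_eq_zero_of_natDegree_lt (show c.natDegree < k + 1 by omega)]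
    ring

/-- The quotient by a monic polynomial of degree `m` in terms of the polynomials of degree less
than `m`. -/
noncomputable def degreeLTEquivQuotient :
    degreeLT (ZMod 2) m ≃ₗ[ZMod 2] ((ZMod 2)[X] ⧸ Submodule.span (ZMod 2)[X] {c}) :=
  LinearEquiv.ofBijective
    ((Submodule.mkQ (Submodule.span (ZMod 2)[X] {c})).restrictScalars (ZMod 2) ∘ₗ
      (degreeLT (ZMod 2) m).subtype) <| by
    constructor
    · rw [← LinearMap.ker_eq_bot, LinearMap.ker_eq_bot']
      intro p hp
      have hp1 : (p : (ZMod 2)[X]) ∈ Submodule.span (ZMod 2)[X] {c} :=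
        (Submodule.Quotient.mk_eq_zero _).1 hp
      have hp2 : c ∣ p := Ideal.mem_span_singleton.1 hp1
      refine Subtype.ext (eq_zero_of_dvd_of_degree_lt hp2 ?_)
      rw [degree_eq_of_monic hc hm]
      exact mem_degreeLT.1 p.2
    · intro y
      obtain ⟨p, rfl⟩ := Submodule.mkQ_surjective _ y
      refine ⟨⟨p %ₘ c, ?_⟩, ?_⟩
      · rw [mem_degreeLT, ← degree_eq_of_monic hc hm]
        exact degree_modByMonic_lt _ hc
      · exact (Submodule.Quotient.eq _).2 (Ideal.mem_span_singleton.2 (dvd_modByMonic_sub p c))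

theorem X_smul_degreeLTEquivQuotient (p : degreeLT (ZMod 2) m) :
    (X : (ZMod 2)[X]) • degreeLTEquivQuotient hc hm p =
      degreeLTEquivQuotient hc hm (mulXMod hc hm p) := by
  refine (Submodule.Quotient.eq _).2 (Ideal.mem_span_singleton.2 ?_)
  have := dvd_modByMonic_sub (X * (p : (ZMod 2)[X])) c
  rw [← dvd_neg] at this
  convert this using 1
  rw [neg_sub]; rfl

end MulXMod

/-! ### Splitting a companion matrix by means of a divisor of `X ^ n - 1` -/

section Cyclic

variable {m n : ℕ} {c q : (ZMod 2)[X]}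

theorem zmod_two_eq_zero_or_one (x : ZMod 2) : x = 0 ∨ x = 1 := by
  revert x; decide

theorem coeff_natDegree_eq_one {c : (ZMod 2)[X]} (hc : c.Monic) (hm : c.natDegree = m) :
    c.coeff m = 1 := by
  rw [← hm]; exact hc

/-- The map `p ↦ p + a • r`, where `a` is the coefficient of degree `m - 1` of `p`. -/
noncomputable def addTopCoeffMul (r : degreeLT (ZMod 2) m) : End (ZMod 2) (degreeLT (ZMod 2) m) :=
  1 + LinearMap.smulRight
    (lcoeff (ZMod 2) (m - 1) ∘ₗ (degreeLT (ZMod 2) m).subtype) r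

theorem addTopCoeffMul_apply (r p : degreeLT (ZMod 2) m) :
    addTopCoeffMul r p = p + (p : (ZMod 2)[X]).coeff (m - 1) • r := rfl

theorem coe_addTopCoeffMul (r p : degreeLT (ZMod 2) m) :
    (addTopCoeffMul r p : (ZMod 2)[X]) =
      p + C ((p : (ZMod 2)[X]).coeff (m - 1)) * (r : (ZMod 2)[X]) := by
  rw [addTopCoeffMul_apply, ← smul_eq_C_mul]; rfl

theorem addTopCoeffMul_mul_self {r : degreeLT (ZMod 2) m}
    (hr : (r : (ZMod 2)[X]).coeff (m - 1) = 0) : addTopCoeffMul r * addTopCoeffMul r = 1 := by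
  refine LinearMap.ext fun p => Subtype.ext ?_
  rw [Module.End.mul_apply, coe_addTopCoeffMul, coe_addTopCoeffMul, coeff_add, coeff_C_mul, hr,
    mul_zero, add_zero, add_assoc, CharTwo.add_self_eq_zero, add_zero, Module.End.one_apply]

/-- The difference is `p ↦ a • (c + q)`, with `a` the top coefficient of `p`. It fixes `c + q`,
whose coefficient of degree `m - 1` is 1. -/
theorem splitsTorsion_of_coeff_ne (hc : c.Monic) (hcm : c.natDegree = m) (hq : q.Monic)
    (hqm : q.natDegree = m) (h1 : 1 ≤ m) (hqn : q ∣ X ^ n - 1)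
    (hne : c.coeff (m - 1) + q.coeff (m - 1) = 1) : SplitsTorsion n (mulXMod hc hcm) := by
  refine ⟨mulXMod hq hqm, mulXMod hc hcm - mulXMod hq hqm, mulXMod_pow_eq_one hq hqm hqn, ?_,
    by abel⟩
  have key : ∀ p, ((mulXMod hc hcm - mulXMod hq hqm) p : (ZMod 2)[X]) =
      C ((p : (ZMod 2)[X]).coeff (m - 1)) * (c + q) := by
    intro p
    have h2 : (2 : (ZMod 2)[X]) = 0 := CharTwo.two_eq_zero
    rw [LinearMap.sub_apply, Submodule.coe_sub, coe_mulXMod_eq hc hcm h1,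
      coe_mulXMod_eq hq hqm h1]
    linear_combination (-(C ((p : (ZMod 2)[X]).coeff (m - 1)) * c)) * h2
  refine LinearMap.ext fun p => Subtype.ext ?_
  rw [Module.End.mul_apply, key, key, coeff_C_mul, coeff_add, hne, mul_one]

/-- After conjugation by the involution `P`, the difference sends `p` to a combination of `s` and
`r` weighted by the top two coefficients of `p`. Those of `s` are `(1, 0)` and those of `r` are `(0,
1)`, so it is a projection onto their span. -/
theorem splitsTorsion_of_coeff_eq (hc : c.Monic) (hcm : c.natDegree = m) (hq : q.Monic)
    (hqm : q.natDegree = m) (h3 : 3 ≤ m) (hqn : q ∣ X ^ n - 1)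
    (heq : c.coeff (m - 1) = q.coeff (m - 1)) : SplitsTorsion n (mulXMod hc hcm) := by
  obtain ⟨k, rfl⟩ : ∃ k, m = k + 3 := ⟨m - 3, by omega⟩
  -- The value that makes `s.coeff (k + 1)` vanish; it is placed in degree `m - 3`, hence `3 ≤ m`.
  set a : ZMod 2 := c.coeff (k + 1) + q.coeff (k + 1) + 1 + q.coeff (k + 2) with ha
  have hrdeg : (X ^ (k + 1) + C a * X ^ k : (ZMod 2)[X]).degree < ((k + 3 : ℕ) : WithBot ℕ) := by
    rw [degree_lt_iff_coeff_zero]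
    intro j hj
    simp [coeff_X_pow, show j ≠ k + 1 by omega, show j ≠ k by omega]
  set r : degreeLT (ZMod 2) (k + 3) := ⟨X ^ (k + 1) + C a * X ^ k, mem_degreeLT.2 hrdeg⟩ with hr
  have hrc : (r : (ZMod 2)[X]) = X ^ (k + 1) + C a * X ^ k := rfl
  have hr2 : (r : (ZMod 2)[X]).coeff (k + 2) = 0 := by
    simp [hrc, coeff_X_pow]
  have hr1 : (r : (ZMod 2)[X]).coeff (k + 1) = 1 := by
    simp [hrc, coeff_X_pow]
  have hr0 : (r : (ZMod 2)[X]).coeff k = a := by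
    simp [hrc, coeff_X_pow]
  have hinv := addTopCoeffMul_mul_self (m := k + 3) hr2
  set P := addTopCoeffMul r
  set U := P * mulXMod hq hqm * P with hU
  set s : (ZMod 2)[X] := c + q + X * (r : (ZMod 2)[X]) + C (1 + q.coeff (k + 2)) * (r : (ZMod 2)[X]) with hs
  have key : ∀ p, ((mulXMod hc hcm - U) p : (ZMod 2)[X]) =
      C ((p : (ZMod 2)[X]).coeff (k + 2)) * s + C ((p : (ZMod 2)[X]).coeff (k + 1)) * (r : (ZMod 2)[X]) := by
    intro p
    have h2 : (2 : (ZMod 2)[X]) = 0 := CharTwo.two_eq_zero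
    rw [LinearMap.sub_apply, Submodule.coe_sub, coe_mulXMod_eq hc hcm (by omega), hU,
      Module.End.mul_apply, Module.End.mul_apply, coe_addTopCoeffMul,
      coe_mulXMod_eq hq hqm (by omega), coe_addTopCoeffMul]
    simp only [show k + 3 - 1 = k + 2 by omega, coeff_add, coeff_sub, coeff_C_mul, coeff_X_mul,
      hr2, hr1, mul_zero, add_zero, mul_one, C_add, C_mul, C_sub, hs, C_1]
    linear_combination (-(C ((p : (ZMod 2)[X]).coeff (k + 2)) * (c + X * (r : (ZMod 2)[X]) + r) +
      C ((p : (ZMod 2)[X]).coeff (k + 1)) * (r : (ZMod 2)[X]))) * h2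
  have hs2 : s.coeff (k + 2) = 1 := by
    simp only [hs, coeff_add, coeff_C_mul, coeff_X_mul, hr2, hr1, mul_zero, add_zero]
    rw [show c.coeff (k + 2) = q.coeff (k + 2) from heq, CharTwo.add_self_eq_zero, zero_add]
  have hs1 : s.coeff (k + 1) = 0 := by
    have h2 : (2 : ZMod 2) = 0 := CharTwo.two_eq_zero
    simp only [hs, coeff_add, coeff_C_mul, coeff_X_mul, hr1, hr0, ha]
    linear_combination (c.coeff (k + 1) + q.coeff (k + 1) + 1 + q.coeff (k + 2)) * h2
  refine ⟨U, mulXMod hc hcm - U, ?_, ?_, by abel⟩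
  · have : ∀ j : ℕ, U ^ j = P * mulXMod hq hqm ^ j * P := by
      intro j
      induction j with
      | zero => simp [hinv]
      | succ j ih =>
        rw [pow_succ, ih, hU]
        calc P * mulXMod hq hqm ^ j * P * (P * mulXMod hq hqm * P)
            = P * mulXMod hq hqm ^ j * (P * P) * mulXMod hq hqm * P := by noncomm_ring
          _ = _ := by rw [hinv, pow_succ]; noncomm_ring
    rw [this, mulXMod_pow_eq_one hq hqm hqn, mul_one, hinv]
  · refine LinearMap.ext fun p => Subtype.ext ?_
    rw [Module.End.mul_apply, key, key]
    simp only [coeff_add, coeff_C_mul, hs2, hs1, hr2, hr1, mul_one, mul_zero, add_zero, zero_add]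

theorem mulXMod_add_one_pow_eq_one (hc : c.Monic) (hcm : c.natDegree = m)
    (h : c ∣ (X + 1) ^ n - 1) : (mulXMod hc hcm + 1) ^ n = 1 := by
  have key : ∀ k, ∀ p : degreeLT (ZMod 2) m, (((mulXMod hc hcm + 1) ^ k) p : (ZMod 2)[X]) =
      ((X + 1) ^ k * (p : (ZMod 2)[X])) %ₘ c := by
    intro k
    induction k with
    | zero => intro p; simp [coe_modByMonic_self hc hcm]
    | succ k ih =>
      intro p
      rw [pow_succ, Module.End.mul_apply, ih]
      refine modByMonic_eq_of_dvd_sub hc ?_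
      rw [LinearMap.add_apply, Submodule.coe_add, coe_mulXMod, Module.End.one_apply]
      have := (dvd_modByMonic_sub (X * (p : (ZMod 2)[X])) c).mul_left ((X + 1) ^ k)
      convert this using 1
      ring
  refine LinearMap.ext fun p => Subtype.ext ?_
  rw [key, Module.End.one_apply]
  nth_rewrite 2 [← coe_modByMonic_self hc hcm p]
  refine modByMonic_eq_of_dvd_sub hc ?_
  convert h.mul_right (p : (ZMod 2)[X]) using 1
  ring

theorem mulXMod_mul_self_eq (hc : c.Monic) (hcm : c.natDegree = m) (h : c ∣ X ^ 2 - X) :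
    mulXMod hc hcm * mulXMod hc hcm = mulXMod hc hcm := by
  refine LinearMap.ext fun p => Subtype.ext ?_
  rw [← pow_two, coe_mulXMod_pow, coe_mulXMod]
  refine modByMonic_eq_of_dvd_sub hc ?_
  convert h.mul_right (p : (ZMod 2)[X]) using 1
  ring

theorem eq_X_add_C_of_monic (hc : c.Monic) (hcm : c.natDegree = 1) : ∃ a, c = X + C a := by
  refine ⟨c.coeff 0, ?_⟩
  conv_lhs => rw [eq_X_add_C_of_natDegree_le_one hcm.le, coeff_natDegree_eq_one hc hcm]
  simp

theorem eq_X_sq_add_of_monic (hc : c.Monic) (hcm : c.natDegree = 2) :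
    ∃ t a, c = X ^ 2 + C t * X + C a := by
  refine ⟨c.coeff 1, c.coeff 0, ?_⟩
  conv_lhs => rw [c.as_sum_range_C_mul_X_pow, hcm]
  simp [Finset.sum_range_succ, coeff_natDegree_eq_one hc hcm]
  ring

theorem splitsTorsion_of_natDegree_eq_one (hc : c.Monic) (hcm : c.natDegree = 1) :
    SplitsTorsion n (mulXMod hc hcm) := by
  have h2 : (2 : (ZMod 2)[X]) = 0 := CharTwo.two_eq_zero
  obtain ⟨a, ha⟩ := eq_X_add_C_of_monic hc hcm
  refine .of_idempotent (mulXMod_mul_self_eq hc hcm ?_)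
  rcases zmod_two_eq_zero_or_one a with rfl | rfl
  · exact ⟨X - 1, by rw [ha, C_0]; ring⟩
  · exact ⟨X, by rw [ha, C_1]; linear_combination (-X) * h2⟩

theorem splitsTorsion_of_natDegree_eq_two (hc : c.Monic) (hcm : c.natDegree = 2) (hq : q.Monic)
    (hqm : q.natDegree = 2) (hqn : q ∣ X ^ n - 1) : SplitsTorsion n (mulXMod hc hcm) := by
  rcases Nat.eq_zero_or_pos n with rfl | hn
  · exact ⟨mulXMod hc hcm, 0, pow_zero _, by simp, by simp⟩
  have h2 : (2 : (ZMod 2)[X]) = 0 := CharTwo.two_eq_zero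
  by_cases hne : c.coeff 1 + q.coeff 1 = 1
  · exact splitsTorsion_of_coeff_ne hc hcm hq hqm (by omega) hqn hne
  obtain ⟨t, a, rfl⟩ := eq_X_sq_add_of_monic hc hcm
  obtain ⟨u, b, rfl⟩ := eq_X_sq_add_of_monic hq hqm
  have htu : u = t := by
    have : ∀ t u : ZMod 2, t + u ≠ 1 → u = t := by decide
    refine this _ _ ?_
    simpa [coeff_X, coeff_C, coeff_X_pow] using hne
  subst htu
  -- `X` does not divide `X ^ n - 1` for positive `n`.
  have hb : b = 1 := by
    refine (zmod_two_eq_zero_or_one b).resolve_left ?_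
    rintro rfl
    have := eval_dvd (x := 0) hqn
    simp [hn.ne'] at this
  subst hb
  rcases zmod_two_eq_zero_or_one a with rfl | rfl
  · rcases zmod_two_eq_zero_or_one u with rfl | rfl
    -- Here `c = X ^ 2` is the translate by 1 of `q = X ^ 2 + 1`.
    · refine .of_add_one_pow (mulXMod_add_one_pow_eq_one _ _ ?_)
      obtain ⟨g, hg⟩ := hqn
      refine ⟨g.comp (X + 1), ?_⟩
      have := congrArg (fun f => f.comp (X + 1)) hg
      simp only [sub_comp, pow_comp, X_comp, one_comp, mul_comp, add_comp, C_comp] at this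
      rw [this]
      simp only [C_0, C_1]
      linear_combination (X + 1) * (g.comp (X + 1)) * h2
    · refine .of_idempotent (mulXMod_mul_self_eq _ _ ⟨1, ?_⟩)
      simp only [C_0, C_1]
      linear_combination (-X) * h2
  · exact .of_pow (mulXMod_pow_eq_one _ _ hqn)

theorem splitsTorsion_of_dvd (hc : c.Monic) (hcm : c.natDegree = m) (hq : q.Monic)
    (hqm : q.natDegree = m) (hm : m ≠ 0) (hqn : q ∣ X ^ n - 1) :
    SplitsTorsion n (mulXMod hc hcm) := by
  by_cases h1 : m = 1
  · subst h1; exact splitsTorsion_of_natDegree_eq_one hc hcm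
  by_cases h2 : m = 2
  · subst h2; exact splitsTorsion_of_natDegree_eq_two hc hcm hq hqm hqn
  by_cases hne : c.coeff (m - 1) + q.coeff (m - 1) = 1
  · exact splitsTorsion_of_coeff_ne hc hcm hq hqm (by omega) hqn hne
  · have : ∀ t u : ZMod 2, t + u ≠ 1 → t = u := by decide
    exact splitsTorsion_of_coeff_eq hc hcm hq hqm (by omega) hqn (this _ _ hne)

end Cyclic

/-! ### Idempotent plus nilpotent for Hessenberg matrices -/

section Hessenberg

variable {V : Type*} [AddCommGroup V] [Module (ZMod 2) V]

/-- An endomorphism given by a Hessenberg matrix with diagonal `d 0, …, d (k - 1), 1` is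
the sum of an idempotent and a nilpotent endomorphism, provided that the ones among the `d i` are
isolated and not too far apart. -/
theorem splitsNilpotent_of_hessenberg {k : ℕ} (v : ℕ → V) (b : Basis (Fin (k + 1)) (ZMod 2) V)
    (hb : ∀ i, b i = v i) (A : End (ZMod 2) V) (d w : ℕ → ZMod 2)
    (hA : ∀ i < k, A (v i) = d i • v i + v (i + 1))
    (hAk : A (v k) = ∑ i ∈ Finset.range k, w i • v i + v k)
    (hd : ∀ i < k, d i = 1 → i + 1 < k ∧ d (i + 1) = 0)
    (hgap : ∀ i, i + 3 ≤ k →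
      (∃ j, i ≤ j ∧ j ≤ i + 3 ∧ j < k ∧ d j = 1) ∨ (i + 3 = k ∧ ∀ j < k, d j = 0)) :
    SplitsNilpotent A := by
  -- `E` is chosen so that `N = A - E` shifts `v i` when `d i = 0` and kills it when `d i = 1`,
  -- while `N (v k)` involves only killed vectors.
  obtain ⟨E, hE, hEk⟩ : ∃ E : End (ZMod 2) V,
      (∀ i < k, E (v i) = d i • (v i + v (i + 1))) ∧
      E (v k) = ∑ i ∈ Finset.range k, ((1 - d i) * w i) • v i + v k := by
    refine ⟨b.constr (ZMod 2) fun i => if (i : ℕ) < k then d i • (v i + v (i + 1)) else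
      ∑ i ∈ Finset.range k, ((1 - d i) * w i) • v i + v k, fun i hi => ?_, ?_⟩
    · have := hb ⟨i, by omega⟩
      simp only at this
      rw [← this, b.constr_basis, if_pos hi]
      simp [hb]
    · have := hb ⟨k, by omega⟩
      simp only at this
      rw [← this, b.constr_basis, if_neg (lt_irrefl k)]
  obtain ⟨N, hNA⟩ : ∃ N, N = A - E := ⟨_, rfl⟩
  have hN : ∀ i < k, N (v i) = (1 - d i) • v (i + 1) := by
    intro i hi
    rw [hNA, LinearMap.sub_apply, hA i hi, hE i hi]
    module
  have hNk : N (v k) = ∑ i ∈ Finset.range k, (d i * w i) • v i := by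
    rw [hNA, LinearMap.sub_apply, hAk, hEk, add_sub_add_right_eq_sub, ← Finset.sum_sub_distrib]
    refine Finset.sum_congr rfl fun i _ => ?_
    module
  have hext : ∀ f g : End (ZMod 2) V, (∀ i ≤ k, f (v i) = g (v i)) → f = g := by
    intro f g h
    refine b.ext fun i => ?_
    rw [hb]
    exact h i (by omega)
  have hdd : ∀ i, (1 - d i) * d i = 0 := fun i => by
    rcases zmod_two_eq_zero_or_one (d i) with h | h <;> simp [h]
  refine ⟨N, E, ?_, ?_, by rw [hNA]; abel⟩
  · have hN1 : ∀ i < k, d i = 1 → N (v i) = 0 := fun i hi h => by simp [hN i hi, h]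
    have hN0 : ∀ i < k, d i = 0 → N (v i) = v (i + 1) := fun i hi h => by simp [hN i hi, h]
    have hNNk : N (N (v k)) = 0 := by
      rw [hNk, map_sum]
      refine Finset.sum_eq_zero fun i hi => ?_
      rw [map_smul, hN i (Finset.mem_range.1 hi), smul_smul,
        show d i * w i * (1 - d i) = (1 - d i) * d i * w i by ring, hdd, zero_mul, zero_smul]
    refine hext _ _ fun i hi => ?_
    have h4 : ∀ x, (N ^ 4) x = N (N (N (N x))) := fun x => rfl
    rw [h4, LinearMap.zero_apply]
    rcases hi.eq_or_lt with rfl | h0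
    · rw [hNNk, map_zero, map_zero]
    rcases zmod_two_eq_zero_or_one (d i) with e0 | e0
    swap
    · rw [hN1 i h0 e0, map_zero, map_zero, map_zero]
    rw [hN0 i h0 e0]
    rcases (show i + 1 ≤ k from h0).eq_or_lt with h | h1
    · rw [h, hNNk, map_zero]
    rcases zmod_two_eq_zero_or_one (d (i + 1)) with e1 | e1
    swap
    · rw [hN1 _ h1 e1, map_zero, map_zero]
    rw [hN0 _ h1 e1]
    rcases (show i + 1 + 1 ≤ k from h1).eq_or_lt with h | h2
    · rw [h, hNNk]
    rcases zmod_two_eq_zero_or_one (d (i + 1 + 1)) with e2 | e2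
    swap
    · rw [hN1 _ h2 e2, map_zero]
    rw [hN0 _ h2 e2]
    -- After three shifts, the vector reached must be killed: either its diagonal entry is 1, or it
    -- is `v k` and every `d j` is 0.
    rcases hgap i h2 with ⟨j, hj1, hj2, hj3, hj4⟩ | ⟨h, hz⟩
    · obtain rfl : j = i + 1 + 1 + 1 := by
        by_contra hne
        have : j = i ∨ j = i + 1 ∨ j = i + 1 + 1 := by omega
        rcases this with h | h | h
        · exact zero_ne_one (e0.symm.trans (h ▸ hj4))
        · exact zero_ne_one (e1.symm.trans (h ▸ hj4))
        · exact zero_ne_one (e2.symm.trans (h ▸ hj4))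
      exact hN1 _ hj3 hj4
    · rw [show i + 1 + 1 + 1 = k from h, hNk]
      exact Finset.sum_eq_zero fun j hj => by simp [hz j (Finset.mem_range.1 hj)]
  · have hEE : ∀ i < k, E (E (v i)) = E (v i) := by
      intro i hi
      rcases zmod_two_eq_zero_or_one (d i) with h | h
      · simp [hE i hi, h]
      · obtain ⟨h1, h2⟩ := hd i hi h
        have : E (v (i + 1)) = 0 := by simp [hE _ h1, h2]
        rw [hE i hi, h, one_smul, map_add, this, add_zero, hE i hi, h, one_smul]
    refine hext _ _ fun i hi => ?_
    rw [Module.End.mul_apply]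
    rcases hi.eq_or_lt with rfl | hi
    · have h := congrArg E hEk
      rw [h, map_add, map_sum, Finset.sum_eq_zero, zero_add]
      intro j hj
      rw [map_smul, hE j (Finset.mem_range.1 hj), smul_smul,
        show (1 - d j) * w j * d j = (1 - d j) * d j * w j by ring, hdd, zero_mul, zero_smul]
    · exact hEE i hi

end Hessenberg

/-! ### Hessenberg form of companion matrices -/

/-- The monic polynomial of degree `i` with roots `d 0, …, d (i - 1)`. -/
noncomputable def rootProd (d : ℕ → ZMod 2) (i : ℕ) : (ZMod 2)[X] :=
  ∏ j ∈ Finset.range i, (X - C (d j))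

section Nilpotent

variable {m n : ℕ} {c : (ZMod 2)[X]} (d : ℕ → ZMod 2)

theorem rootProd_monic (i : ℕ) : (rootProd d i).Monic :=
  monic_prod_of_monic _ _ fun j _ => monic_X_sub_C (d j)

theorem natDegree_rootProd (i : ℕ) : (rootProd d i).natDegree = i := by
  rw [rootProd, natDegree_prod_of_monic _ _ fun j _ => monic_X_sub_C (d j)]
  simp

theorem degree_rootProd (i : ℕ) : (rootProd d i).degree = i :=
  degree_eq_of_monic (rootProd_monic d i) (natDegree_rootProd d i)

theorem rootProd_succ (i : ℕ) : rootProd d (i + 1) = rootProd d i * (X - C (d i)) :=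
  Finset.prod_range_succ _ _

theorem coeff_rootProd_succ (k : ℕ) :
    (rootProd d (k + 1)).coeff k = -∑ i ∈ Finset.range (k + 1), d i := by
  have h := prod_X_sub_C_coeff_card_pred (Finset.range (k + 1)) d (by simp)
  simpa [rootProd] using h

/-- In the basis `rootProd d i`, multiplication by `X` is Hessenberg with diagonal `d`. Its trace is
`c.coeff k`, so `htr` says that the last diagonal entry is 1. -/
theorem splitsNilpotent_mulXMod {k : ℕ} (hc : c.Monic) (hcm : c.natDegree = k + 1)
    (htr : c.coeff k + ∑ i ∈ Finset.range k, d i = 1)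
    (hd : ∀ i < k, d i = 1 → i + 1 < k ∧ d (i + 1) = 0)
    (hgap : ∀ i, i + 3 ≤ k →
      (∃ j, i ≤ j ∧ j ≤ i + 3 ∧ j < k ∧ d j = 1) ∨ (i + 3 = k ∧ ∀ j < k, d j = 0)) :
    SplitsNilpotent (mulXMod hc hcm) := by
  have hlt : ∀ i, i < k + 1 → rootProd d i ∈ degreeLT (ZMod 2) (k + 1) := fun i hi => by
    rw [mem_degreeLT, degree_rootProd]; exact_mod_cast hi
  let v : ℕ → degreeLT (ZMod 2) (k + 1) := fun i =>
    if hi : i < k + 1 then ⟨rootProd d i, hlt i hi⟩ else 0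
  have hv : ∀ i ≤ k, (v i : (ZMod 2)[X]) = rootProd d i := fun i hi => by
    simp only [v, dif_pos (Nat.lt_succ_of_le hi)]
  let S : Polynomial.Sequence (ZMod 2) := ⟨rootProd d, degree_rootProd d⟩
  have hli : LinearIndependent (ZMod 2) fun i : Fin (k + 1) => v i := by
    refine LinearIndependent.of_comp (degreeLT (ZMod 2) (k + 1)).subtype ?_
    have hS : LinearIndependent (ZMod 2) (rootProd d) := S.linearIndependent
    have := hS.comp (fun i : Fin (k + 1) => (i : ℕ)) Fin.val_injective
    convert this using 1
    funext i
    exact hv i (by omega)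
  have hfr : Module.finrank (ZMod 2) (degreeLT (ZMod 2) (k + 1)) = k + 1 := by
    rw [(degreeLTEquiv (ZMod 2) (k + 1)).finrank_eq]; simp
  let b := basisOfLinearIndependentOfCardEqFinrank hli (by simp [hfr])
  have hb : ∀ i, b i = v i := fun i => by simp [b]
  have hrc : ∀ i < k, (rootProd d i).coeff k = 0 := fun i hi =>
    coeff_eq_zero_of_natDegree_lt (by rwa [natDegree_rootProd])
  have hrk : (rootProd d k).coeff k = 1 :=
    coeff_natDegree_eq_one (rootProd_monic d k) (natDegree_rootProd d k)
  have hexp : ∃ w : ℕ → ZMod 2, mulXMod hc hcm (v k) =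
      ∑ i ∈ Finset.range k, w i • v i + w k • v k := by
    refine ⟨fun i => if hi : i < k + 1 then b.repr (mulXMod hc hcm (v k)) ⟨i, hi⟩ else 0, ?_⟩
    rw [← Finset.sum_range_succ (fun i => (if hi : i < k + 1 then
      b.repr (mulXMod hc hcm (v k)) ⟨i, hi⟩ else 0) • v i), Finset.sum_range]
    conv_lhs => rw [← b.sum_repr (mulXMod hc hcm (v k))]
    exact Finset.sum_congr rfl fun i _ => by rw [hb, dif_pos i.2]
  obtain ⟨w, hw⟩ := hexp
  have hwk : w k = 1 := by
    have h1 := congrArg (fun p : degreeLT (ZMod 2) (k + 1) => (p : (ZMod 2)[X]).coeff k) hw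
    simp only [Submodule.coe_add, Submodule.coe_sum, Submodule.coe_smul, coeff_add,
      finsetSum_coeff, coeff_smul, hv k le_rfl, hrk] at h1
    rw [Finset.sum_eq_zero (fun i hi => by
      rw [hv i (Finset.mem_range.1 hi).le, hrc i (Finset.mem_range.1 hi), smul_zero]),
      coe_mulXMod_eq hc hcm (by omega), hv k le_rfl, Nat.add_sub_cancel, hrk, C_1, one_mul,
      coeff_sub, zero_add, smul_eq_mul, mul_one] at h1
    rw [← h1, ← htr, CharTwo.sub_eq_add, add_comm]
    congr 1
    rcases k with _ | k
    · simp
    · rw [coeff_X_mul, coeff_rootProd_succ, CharTwo.neg_eq]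
  refine splitsNilpotent_of_hessenberg v b hb _ d w (fun i hi => Subtype.ext ?_) ?_ hd hgap
  · rw [coe_mulXMod_eq hc hcm (by omega), Submodule.coe_add, Submodule.coe_smul, hv i hi.le,
      hv (i + 1) hi, rootProd_succ, Nat.add_sub_cancel, hrc i hi, smul_eq_C_mul]
    simp only [C_0]
    ring
  · rw [hw, hwk, one_smul]

theorem splitsTorsion_four_mul (hc : c.Monic) (hcm : c.natDegree = m) (hm : m ≠ 0) (hn : 4 ∣ n) :
    SplitsTorsion n (mulXMod hc hcm) := by
  have h2 : (2 : (ZMod 2)[X]) = 0 := CharTwo.two_eq_zero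
  by_cases hm1 : m = 1
  · subst hm1; exact splitsTorsion_of_natDegree_eq_one hc hcm
  by_cases hm2 : m = 2
  · subst hm2
    refine splitsTorsion_of_natDegree_eq_two (q := X ^ 2 + C 1) hc hcm
      (monic_X_pow_add_C 1 two_ne_zero) natDegree_X_pow_add_C ?_
    · obtain ⟨k, rfl⟩ := hn
      refine Dvd.dvd.trans ?_ (pow_one_sub_dvd_pow_mul_sub_one X 4 k)
      exact ⟨X ^ 2 - 1, by rw [C_1]; ring⟩
  obtain ⟨k, rfl⟩ : ∃ k, m = k + 1 := ⟨m - 1, by omega⟩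
  refine SplitsNilpotent.splitsTorsion ?_ hn
  -- Ones in every second place, ending at `k - 2`; `d₂` drops the first of them. The two sums
  -- differ by 1, so one of the two meets the trace condition.
  set d₁ : ℕ → ZMod 2 := fun i => if i + 2 ≤ k ∧ i % 2 = k % 2 then 1 else 0 with hd₁
  set d₂ : ℕ → ZMod 2 := fun i => if 2 ≤ i ∧ i + 2 ≤ k ∧ i % 2 = k % 2 then 1 else 0 with hd₂
  have hsum : ∑ i ∈ Finset.range k, d₁ i = 1 + ∑ i ∈ Finset.range k, d₂ i := by
    obtain ⟨l, rfl⟩ : ∃ l, k = l + 2 := ⟨k - 2, by omega⟩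
    rw [Finset.sum_range_succ', Finset.sum_range_succ', Finset.sum_range_succ' _ (l + 1),
      Finset.sum_range_succ' _ l]
    have e : ∑ i ∈ Finset.range l, d₁ (i + 1 + 1) = ∑ i ∈ Finset.range l, d₂ (i + 1 + 1) :=
      Finset.sum_congr rfl fun i _ => by simp [hd₁, hd₂]
    have e0 : d₂ 0 = 0 := by simp [hd₂]
    have e1 : d₂ (0 + 1) = 0 := by simp [hd₂]
    have e2 : d₁ (0 + 1) + d₁ 0 = 1 := by
      simp only [hd₁]
      rcases Nat.mod_two_eq_zero_or_one l with h | h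
      · rw [if_neg (by omega), if_pos (by omega), zero_add]
      · rw [if_pos (by omega), if_neg (by omega), add_zero]
    rw [e, e0, e1, add_assoc, e2, add_zero, add_zero, add_comm]
  have hone : ∀ (P : Prop) [Decidable P], (if P then (1 : ZMod 2) else 0) = 1 ↔ P := by
    intro P _; split_ifs <;> simp_all
  have hzero : ∀ (P : Prop) [Decidable P], (if P then (1 : ZMod 2) else 0) = 0 ↔ ¬ P := by
    intro P _; split_ifs <;> simp_all
  rcases zmod_two_eq_zero_or_one (c.coeff k + ∑ i ∈ Finset.range k, d₁ i) with h | h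
  · refine splitsNilpotent_mulXMod d₂ hc hcm ?_ ?_ ?_
    · have : ∀ x y z : ZMod 2, x + y = 0 → y = 1 + z → x + z = 1 := by decide
      exact this _ _ _ h hsum
    · simp only [hd₂, hone, hzero]
      omega
    · simp only [hd₂, hone, hzero]
      intro i hi
      -- For `k = 3` dropping the only one leaves `d₂` zero, the exceptional case of the gap
      -- condition.
      by_cases h3 : k = 3
      · exact Or.inr ⟨by omega, fun j hj => by omega⟩
      · refine Or.inl ?_
        have hj : ∀ j, i ≤ j ∧ j ≤ i + 3 ∧ 2 ≤ j ∧ j + 2 ≤ k ∧ j % 2 = k % 2 →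
            ∃ j, i ≤ j ∧ j ≤ i + 3 ∧ j < k ∧ 2 ≤ j ∧ j + 2 ≤ k ∧ j % 2 = k % 2 :=
          fun j hj => ⟨j, by omega⟩
        by_cases hi2 : 2 ≤ i
        · by_cases hp : i % 2 = k % 2
          · exact hj i (by omega)
          · exact hj (i + 1) (by omega)
        · by_cases hp : k % 2 = 0
          · exact hj 2 (by omega)
          · exact hj 3 (by omega)
  · refine splitsNilpotent_mulXMod d₁ hc hcm h ?_ ?_
    · simp only [hd₁, hone, hzero]
      omega
    · simp only [hd₁, hone, hzero]
      intro i hi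
      refine Or.inl ?_
      by_cases hp : i % 2 = k % 2
      · exact ⟨i, by omega⟩
      · exact ⟨i + 1, by omega⟩

end Nilpotent

/-! ### Reduction to companion matrices -/

theorem monic_of_ne_zero_zmod_two {c : (ZMod 2)[X]} (hc : c ≠ 0) : c.Monic :=
  (zmod_two_eq_zero_or_one _).resolve_left (leadingCoeff_ne_zero.2 hc)

theorem SplitsTorsion.of_forall_mulXMod {n : ℕ} {V : Type*} [AddCommGroup V] [Module (ZMod 2) V]
    [FiniteDimensional (ZMod 2) V]
    (h : ∀ (m : ℕ) (c : (ZMod 2)[X]) (hc : c.Monic) (hm : c.natDegree = m), m ≠ 0 →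
      m ≤ finrank (ZMod 2) V → SplitsTorsion n (mulXMod hc hm))
    (A : End (ZMod 2) V) : SplitsTorsion n A := by
  classical
  obtain ⟨ι, _, p, hp, e, ⟨φ⟩⟩ := Module.equiv_directSum_of_isTorsion
    (Module.AEval.isTorsion_of_finiteDimensional (ZMod 2) V A)
  let M : ι → Type := fun i => (ZMod 2)[X] ⧸ Submodule.span (ZMod 2)[X] {p i ^ e i}
  let ψ : AEval' A ≃ₗ[(ZMod 2)[X]] (∀ i, M i) :=
    φ.trans (DirectSum.linearEquivFunOnFintype (ZMod 2)[X] ι M)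
  let θ : V ≃ₗ[ZMod 2] (∀ i, M i) :=
    (AEval'.of A).trans (ψ.restrictScalars (ZMod 2))
  have hθ : ∀ x, θ (A x) = (X : (ZMod 2)[X]) • θ x := fun x => by
    have := ψ.map_smul (X : (ZMod 2)[X]) (AEval'.of A x)
    rw [AEval'.X_smul_of] at this
    exact this
  have hmon : ∀ i, (p i ^ e i).Monic := fun i =>
    monic_of_ne_zero_zmod_two (pow_ne_zero _ (hp i).ne_zero)
  let B : ∀ i, End (ZMod 2) (M i) := fun i =>
    LinearMap.restrictScalars (ZMod 2) (LinearMap.lsmul (ZMod 2)[X] (M i) X)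
  have hB : ∀ i, SplitsTorsion n (B i) := by
    intro i
    have hfin : FiniteDimensional (ZMod 2) (∀ i, M i) := θ.finiteDimensional
    -- The exponent `e i` may be 0, which gives a zero block.
    by_cases h0 : (p i ^ e i).natDegree = 0
    · have h1 : p i ^ e i = 1 := (hmon i).natDegree_eq_zero.1 h0
      have : Subsingleton (M i) := by
        rw [Submodule.Quotient.subsingleton_iff, h1]
        exact Ideal.span_singleton_one
      exact ⟨1, 0, one_pow n, by simp, Subsingleton.elim _ _⟩
    · refine (h _ _ (hmon i) rfl h0 ?_).conj (degreeLTEquivQuotient (hmon i) rfl)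
        (X_smul_degreeLTEquivQuotient (hmon i) rfl)
      have hdim : finrank (ZMod 2) (M i) = (p i ^ e i).natDegree :=
        finrank_quotient_span_eq_natDegree
      rw [θ.finrank_eq, ← hdim]
      exact LinearMap.finrank_le_finrank_of_injective (f := LinearMap.single (ZMod 2) M i)
        (Pi.single_injective i)
  refine (SplitsTorsion.pi hB).conj θ.symm fun y => ?_
  rw [LinearEquiv.eq_symm_apply, hθ, LinearEquiv.apply_symm_apply]
  rfl

theorem isAlmostTorsionClean_matrix {n k : ℕ} (hk : k ≠ 0)
    (h : ∀ A : End (ZMod 2) (Fin n → ZMod 2), SplitsTorsion k A) :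
    IsAlmostTorsionClean (Matrix (Fin n) (Fin n) (ZMod 2)) k := by
  intro r
  obtain ⟨U, E, hU, hE, hr⟩ := h (Matrix.toLinAlgEquiv' r)
  have hu : Matrix.toLinAlgEquiv'.symm U ^ k = 1 := by rw [← map_pow, hU, map_one]
  refine ⟨Units.ofPowEqOne _ k hu hk, Matrix.toLinAlgEquiv'.symm E, ?_, ?_, ?_⟩
  · exact Units.ext (by simp)
  · rw [IsIdempotentElem, ← map_mul, hE]
  · rw [Units.val_ofPowEqOne, ← map_add, ← hr, AlgEquiv.symm_apply_apply]

/-! ### The exponent 44 and the conclusion -/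

theorem irreducible_cyclotomic_eleven : Irreducible (cyclotomic 11 (ZMod 2)) := by
  refine ZMod.irreducible_of_dvd_cyclotomic_of_natDegree (p := 2) (n := 11) (by norm_num)
    dvd_rfl ?_
  -- Irreducible factors have degree the order of 2 modulo 11, so 2 has to be a primitive root.
  rw [natDegree_cyclotomic, show Nat.totient 11 = 9 + 1 from rfl, eq_comm]
  refine orderOf_eq_of_pow_and_pow_div_prime (by norm_num) (by decide) ?_
  intro p hp hd
  have : p ∈ Nat.primeFactors 10 := Nat.mem_primeFactors.2 ⟨hp, hd, by norm_num⟩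
  have h : Nat.primeFactors 10 = {2, 5} := by decide +kernel
  rw [h] at this
  simp only [Finset.mem_insert, Finset.mem_singleton] at this
  rcases this with rfl | rfl <;> decide

theorem X_pow_forty_four_sub_one :
    (X ^ 44 - 1 : (ZMod 2)[X]) = (X - 1) ^ 4 * cyclotomic 11 (ZMod 2) ^ 4 := by
  have : Fact (Nat.Prime 11) := ⟨by norm_num⟩
  have h := cyclotomic_prime_mul_X_sub_one (ZMod 2) 11
  rw [← mul_pow, mul_comm (X - 1), h]
  have : Fact (Nat.Prime 2) := ⟨Nat.prime_two⟩
  have := sub_pow_char_pow (R := (ZMod 2)[X]) (p := 2) (n := 2) (X ^ 11) 1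
  norm_num at this
  rw [this, ← pow_mul]

theorem not_isPPractical_two_forty_four : ¬ IsPPractical 2 44 := by
  intro h
  obtain ⟨d, hd, hdeg⟩ := h 5 (by norm_num)
  rw [X_pow_forty_four_sub_one] at hd
  have hcop : IsCoprime (cyclotomic 11 (ZMod 2)) d := by
    refine irreducible_cyclotomic_eleven.coprime_iff_not_dvd.2 fun hdvd => ?_
    have hd0 : d ≠ 0 := by rintro rfl; simp at hdeg
    have := natDegree_le_of_dvd hdvd hd0
    rw [natDegree_cyclotomic, show Nat.totient 11 = 10 from rfl, hdeg] at this
    omega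
  have h1 : d ∣ (X - 1) ^ 4 := (hcop.symm.pow_right).dvd_of_dvd_mul_right hd
  have h2 : ((X : (ZMod 2)[X]) - 1).Monic := monic_X_sub_C 1
  have h3 : ((X : (ZMod 2)[X]) - 1).natDegree = 1 := natDegree_X_sub_C 1
  have := natDegree_le_of_dvd h1 (h2.pow 4).ne_zero
  rw [h2.natDegree_pow, h3, hdeg] at this
  omega

theorem theorem2p5 :
    (∀ n : ℕ, 2 < n → IsPPractical 2 n →
      IsAlmostTorsionClean (Matrix (Fin n) (Fin n) (ZMod 2)) n) ∧
    (¬ IsPPractical 2 44 ∧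
      IsAlmostTorsionClean (Matrix (Fin 44) (Fin 44) (ZMod 2)) 44) := by
  refine ⟨fun n hn hp => ?_, not_isPPractical_two_forty_four, ?_⟩
  · refine isAlmostTorsionClean_matrix (by omega) (SplitsTorsion.of_forall_mulXMod ?_)
    intro m c hc hcm hm hle
    obtain ⟨q, hqn, hqm⟩ := hp m (by simpa using hle)
    have hq : q ≠ 0 := by rintro rfl; exact hm (by simpa using hqm.symm)
    exact splitsTorsion_of_dvd hc hcm (monic_of_ne_zero_zmod_two hq) hqm hm hqn
  · refine isAlmostTorsionClean_matrix (by norm_num) (SplitsTorsion.of_forall_mulXMod ?_)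
    intro m c hc hcm hm _
    exact splitsTorsion_four_mul hc hcm hm (by norm_num)
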